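/- For integers $n\ge 1$ and $m$, let $$H(n,m)=\langle x_0,\dots,x_{n-1}\mid x_i x_{i+m}=x_{i+1}\ (0\le i<n)\rangle$$ (subscripts taken modulo $n$) be the Gilbert–Howie group; it depends only on $m$ modulo $n$. Let $n=2\cdot 3^s$ with $s\ge 2$, and let $m$ be an integer with $m\equiv 2+n/3 \pmod n$ or $m\equiv 2-n/3\pmod n$. Then the abelianization $H(n,m)^{\mathrm{ab}}$ is not isomorphic to $\mathbb{Z}^2$; moreover, $H(n,m)^{\mathrm{ab}}$ has nontrivial torsion, i.e. it contains a nontrivial element of finite order. -/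

import Mathlib

/-- The relators `x_i * x_{i+m} * x_{i+k}⁻¹` of the cyclic presentation of `G_n(m,k)`, one for each
`i` in `ℤ/n`; the generators are indexed by `ℤ/n`, and so are the subscripts. -/
def fibonacciTypeRels (n : ℕ) (m k : ℤ) : Set (FreeGroup (ZMod n)) :=
  Set.range fun i : ZMod n =>
    FreeGroup.of i * FreeGroup.of (i + (m : ZMod n)) * (FreeGroup.of (i + (k : ZMod n)))⁻¹

/-- The Fibonacci-type cyclically presented group
`G_n(m,k) = ⟨x_0, …, x_{n-1} | x_i x_{i+m} = x_{i+k} (0 ≤ i < n)⟩`, subscripts modulo `n`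
(for `n ≥ 1`). -/
abbrev FibonacciTypeGroup (n : ℕ) (m k : ℤ) : Type :=
  PresentedGroup (fibonacciTypeRels n m k)

/-- The Gilbert–Howie group `H(n,m) = G_n(m,1)`. -/
abbrev GilbertHowieGroup (n : ℕ) (m : ℤ) : Type :=
  FibonacciTypeGroup n m 1

/-! With q = 3^(s-1) and n = 6q, the abelianization is ℤ[X]/(X^n - 1, f), where f = 1 - X + uX², u =
X^(2rq), u³ = 1 and r is 1 or 2. The torsion element is the class of y = 1 - X + X². Finite order:
(u²+u+1)y = (u²+u+1)f, so any integer in (f, u²+u+1) kills y; `intCast_norm_eq_zero` and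
`norm_one_sub_sq_ne_zero` give a nonzero one. Nontriviality: `exists_field_root` gives a root a of f
in a field with u a primitive cube root of unity; there y(a) = 0 would force (u-1)a² = 0. Both rest
on A = a^q and B = b^q for the two roots a, b of f over ℤ[ω]: AB = 1 and A + B = 1 + 3t with t =
`powSum j`. -/

/-- The ring `ℤ[ω]` of Eisenstein integers, with `ω² = -1 - ω`. -/
abbrev EisensteinInteger : Type := QuadraticAlgebra ℤ (-1) (-1)

/-! ### Arithmetic of ℤ[ω] and power sums of the roots. -/

namespace EisensteinInteger

open scoped QuadraticAlgebra

lemma norm_eq (z : EisensteinInteger) :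
    QuadraticAlgebra.norm z = z.re * z.re - z.re * z.im + z.im * z.im := by
  rw [QuadraticAlgebra.norm_def]; ring

lemma eq_zero_of_norm_eq_zero {z : EisensteinInteger} (h : QuadraticAlgebra.norm z = 0) :
    z = 0 := by
  rw [norm_eq] at h
  have h1 : z.im = 0 := by nlinarith [sq_nonneg (2 * z.re - z.im), sq_nonneg z.im]
  have h2 : z.re = 0 := by simpa [h1] using h
  ext <;> simp [h1, h2]

lemma eq_zero_or_eq_zero_of_mul {z w : EisensteinInteger} (h : z * w = 0) : z = 0 ∨ w = 0 := by
  have h1 : QuadraticAlgebra.norm z * QuadraticAlgebra.norm w = 0 := by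
    rw [← map_mul, h, QuadraticAlgebra.norm_zero]
  exact (mul_eq_zero.mp h1).imp eq_zero_of_norm_eq_zero eq_zero_of_norm_eq_zero

/-- Evaluation of Eisenstein integers at a root `u` of `X² + X + 1`. -/
noncomputable def evalHom {S : Type*} [CommRing S] (u : S) (hu : u ^ 2 + u + 1 = 0) :
    EisensteinInteger →+* S :=
  (QuadraticAlgebra.lift (R := ℤ) (a := -1) (b := -1)
    ⟨u, by simp only [neg_smul, one_smul]; linear_combination hu⟩ :
      EisensteinInteger →ₐ[ℤ] S).toRingHom

@[simp]
lemma evalHom_omega {S : Type*} [CommRing S] (u : S) (hu : u ^ 2 + u + 1 = 0) :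
    evalHom u hu QuadraticAlgebra.omega = u := by
  simp [evalHom, QuadraticAlgebra.lift]

/-- The sequence `t` for which `1 + 3 t j` is the `3 ^ (j + 1)`-th power sum of the roots of
`X² - ω² X + ω²`. -/
def powSum : ℕ → EisensteinInteger
  | 0 => -QuadraticAlgebra.omega
  | j + 1 => -1 + 9 * (powSum j ^ 2 * (1 + powSum j))

lemma powSum_ne_zero (j : ℕ) : powSum j ≠ 0 := by
  intro h
  have him := congrArg QuadraticAlgebra.im h
  have hre := congrArg QuadraticAlgebra.re h
  cases j with
  | zero => simp [powSum] at him
  | succ j =>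
    rw [powSum] at hre
    generalize powSum j ^ 2 * (1 + powSum j) = z at hre
    simp at hre
    omega

lemma powSum_ne_neg_one (j : ℕ) : powSum j ≠ -1 := by
  induction j with
  | zero =>
    intro h
    have him := congrArg QuadraticAlgebra.im h
    simp [powSum] at him
  | succ j ih =>
    intro h
    have h9 : (9 : EisensteinInteger) * (powSum j ^ 2 * (1 + powSum j)) = 0 := by
      rw [powSum] at h; linear_combination h
    rcases eq_zero_or_eq_zero_of_mul h9 with h | h
    · have hre := congrArg QuadraticAlgebra.re h
      simp at hre
    · rcases eq_zero_or_eq_zero_of_mul h with h | h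
      · rw [pow_two] at h
        exact powSum_ne_zero j ((eq_zero_or_eq_zero_of_mul h).elim id id)
      · exact ih (by linear_combination h)

/-- The only unit of ℤ[ω] congruent to 2 modulo 3 is -1. Hence some maximal ideal contains 2 + 3t,
and modulo it A + B = -1. -/
lemma not_isUnit_two_add_three_mul {t : EisensteinInteger} (ht : t ≠ -1) :
    ¬ IsUnit (2 + 3 * t) := by
  intro h
  rw [QuadraticAlgebra.isUnit_iff_norm_isUnit, Int.isUnit_iff, norm_eq] at h
  apply ht
  have hre : (2 + 3 * t : EisensteinInteger).re = 2 + 3 * t.re := by simp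
  have him : (2 + 3 * t : EisensteinInteger).im = 3 * t.im := by simp
  rw [hre, him] at h
  have h1 : t.im = 0 := by
    rcases h with h | h <;>
      nlinarith [sq_nonneg (2 * (2 + 3 * t.re) - 3 * t.im), sq_nonneg t.im]
  rw [h1] at h
  have h2 : t.re = -1 := by
    rcases h with h | h
    · have : (t.re + 1) * (3 * t.re + 1) = 0 := by linarith
      rcases mul_eq_zero.mp this with h | h <;> omega
    · nlinarith [sq_nonneg (2 + 3 * t.re)]
  ext <;> simp [h1, h2]

lemma norm_one_sub_sq_ne_zero (j : ℕ) :
    QuadraticAlgebra.norm (1 - (1 + 3 * powSum j) ^ 2) ≠ 0 := by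
  intro h
  have h0 : (3 : EisensteinInteger) * (powSum j * (2 + 3 * powSum j)) = 0 := by
    linear_combination -eq_zero_of_norm_eq_zero h
  rcases eq_zero_or_eq_zero_of_mul h0 with h | h
  · have hre := congrArg QuadraticAlgebra.re h
    simp at hre
  · rcases eq_zero_or_eq_zero_of_mul h with h | h
    · exact powSum_ne_zero j h
    · have hre := congrArg QuadraticAlgebra.re h
      simp at hre
      omega

section Eval

variable {S : Type*} [CommRing S] {u a b : S}

lemma pow_three_pow_mul (hu : u ^ 2 + u + 1 = 0) (hab : a * b = u ^ 2) (j : ℕ) :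
    a ^ 3 ^ (j + 1) * b ^ 3 ^ (j + 1) = 1 := by
  have h3 : (u ^ 2) ^ 3 = 1 := by
    linear_combination (u ^ 4 - u ^ 3 + u - 1) * hu
  rw [← mul_pow, hab, pow_succ' 3, pow_mul, h3, one_pow]

/-- Cubing sends A + B to (A + B)³ - 3(A + B) when AB = 1, which is the recursion of `powSum`. -/
lemma pow_three_pow_add (hu : u ^ 2 + u + 1 = 0) (hab : a * b = u ^ 2) (hs : a + b = u ^ 2)
    (j : ℕ) :
    a ^ 3 ^ (j + 1) + b ^ 3 ^ (j + 1) = evalHom u hu (1 + 3 * powSum j) := by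
  induction j with
  | zero =>
    have h3 : u ^ 3 = 1 := by linear_combination (u - 1) * hu
    simp only [powSum, map_add, map_mul, map_neg, map_one, map_ofNat, evalHom_omega]
    have : a ^ 3 + b ^ 3 = (a + b) ^ 3 - 3 * (a * b) * (a + b) := by ring
    simp only [zero_add, pow_one]
    rw [this, hab, hs]
    linear_combination (u ^ 3 + 1 - 3 * u) * h3
  | succ j ih =>
    have hm := pow_three_pow_mul hu hab j
    rw [pow_succ 3 (j + 1), pow_mul, pow_mul]
    generalize a ^ 3 ^ (j + 1) = A at *
    generalize b ^ 3 ^ (j + 1) = B at *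
    have : A ^ 3 + B ^ 3 = (A + B) ^ 3 - 3 * (A * B) * (A + B) := by ring
    rw [this, hm, ih, powSum]
    simp only [map_add, map_mul, map_neg, map_one, map_ofNat, map_pow]
    ring

/-- A common root of `1 - X + u X²` and `X ^ (2 q) - u ^ r` with `q = 3 ^ (j + 1)` forces a nonzero
integer to vanish. -/
lemma intCast_norm_eq_zero (hu : u ^ 2 + u + 1 = 0) (ha : 1 - a + u * a ^ 2 = 0) {r : ℕ}
    (hr : r = 1 ∨ r = 2) {j : ℕ} (hpow : (a ^ 3 ^ (j + 1)) ^ 2 = u ^ r) :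
    ((QuadraticAlgebra.norm (1 - (1 + 3 * powSum j) ^ 2 : EisensteinInteger) : ℤ) : S) = 0 := by
  have h3 : u ^ 3 = 1 := by linear_combination (u - 1) * hu
  have hab : a * (u ^ 2 - a) = u ^ 2 := by
    linear_combination a ^ 2 * h3 - u ^ 2 * ha
  have hm := pow_three_pow_mul hu hab j
  have hs := pow_three_pow_add hu hab (by ring) j
  generalize a ^ 3 ^ (j + 1) = A at *
  generalize (u ^ 2 - a) ^ 3 ^ (j + 1) = B at *
  have hB : B ^ 2 = u ^ (3 - r) := by
    have h1 : u ^ r * u ^ (3 - r) = 1 := by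
      rcases hr with rfl | rfl <;> linear_combination h3
    calc B ^ 2 = (u ^ r * u ^ (3 - r)) * B ^ 2 := by rw [h1, one_mul]
      _ = u ^ (3 - r) * (A * B) ^ 2 := by rw [← hpow]; ring
      _ = _ := by rw [hm]; ring
  -- With AB = 1 this gives (A + B)² = 1.
  have hsq : A ^ 2 + B ^ 2 = -1 := by
    rw [hpow, hB]; rcases hr with rfl | rfl <;> linear_combination hu
  have hz : evalHom u hu (1 - (1 + 3 * powSum j) ^ 2) = 0 := by
    rw [map_sub, map_pow, ← hs, map_one]
    linear_combination -hsq - 2 * hm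
  rw [← map_intCast (evalHom u hu), ← eq_intCast (algebraMap ℤ EisensteinInteger),
    QuadraticAlgebra.algebraMap_norm_eq_mul_star, map_mul, hz, zero_mul]

end Eval

/-- Over a suitable field of positive characteristic the polynomials `1 - X + u X²` and
`X ^ q - u ^ k`, with `q = 3 ^ (j + 1)` and `u` a primitive cube root of unity, have a common
root. -/
lemma exists_field_root (j : ℕ) {k : ℕ} (hk : k = 1 ∨ k = 2) :
    ∃ (K : Type) (_ : Field K) (u a : K), u ^ 2 + u + 1 = 0 ∧ u ≠ 1 ∧
      1 - a + u * a ^ 2 = 0 ∧ a ^ 3 ^ (j + 1) = u ^ k := by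
  obtain ⟨M, hM, hmem⟩ :=
    exists_max_ideal_of_mem_nonunits (not_isUnit_two_add_three_mul (powSum_ne_neg_one j))
  let _ : Field (EisensteinInteger ⧸ M) := Ideal.Quotient.field M
  let K := AlgebraicClosure (EisensteinInteger ⧸ M)
  let f : EisensteinInteger →+* K :=
    (algebraMap (EisensteinInteger ⧸ M) K).comp (Ideal.Quotient.mk M)
  set u : K := f QuadraticAlgebra.omega with hu_def
  have hu : u ^ 2 + u + 1 = 0 := by
    have : (QuadraticAlgebra.omega : EisensteinInteger) ^ 2 + QuadraticAlgebra.omega + 1 = 0 := by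
      ext <;> simp [pow_two]
    rw [hu_def, ← map_pow, ← map_add, ← map_one f, ← map_add, this, map_zero]
  have hf : evalHom u hu = f := by
    have : (evalHom u hu).toIntAlgHom = f.toIntAlgHom :=
      QuadraticAlgebra.algHom_ext (by simp [hu_def])
    ext z
    exact DFunLike.congr_fun this z
  have hV : f (2 + 3 * powSum j) = 0 := by
    simp [f, Ideal.Quotient.eq_zero_iff_mem.mpr hmem]
  have hV' : (2 : K) + 3 * f (powSum j) = 0 := by
    rwa [map_add, map_mul, map_ofNat, map_ofNat] at hV
  have hu1 : u ≠ 1 := by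
    intro h
    rw [h] at hu
    have h3 : (3 : K) = 0 := by linear_combination hu
    rw [h3] at hV'
    exact one_ne_zero (α := K) (by linear_combination h3 - hV')
  obtain ⟨a, ha⟩ : ∃ a : K, a ^ 2 - u ^ 2 * a + u ^ 2 = 0 := by
    obtain ⟨a, ha⟩ := IsAlgClosed.exists_root
      (Polynomial.C 1 * Polynomial.X ^ 2 + Polynomial.C (-u ^ 2) * Polynomial.X
        + Polynomial.C (u ^ 2)) (by rw [Polynomial.degree_quadratic one_ne_zero]; decide)
    refine ⟨a, ?_⟩
    simp at ha
    linear_combination ha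
  have h3 : u ^ 3 = 1 := by linear_combination (u - 1) * hu
  have hm := pow_three_pow_mul (a := a) (b := u ^ 2 - a) hu (by linear_combination -ha) j
  have hs := pow_three_pow_add (a := a) (b := u ^ 2 - a) hu (by linear_combination -ha) (by ring) j
  rw [hf, map_add, map_mul, map_one, map_ofNat] at hs
  have hroot : ∀ x : K, x ^ 2 - u ^ 2 * x + u ^ 2 = 0 → 1 - x + u * x ^ 2 = 0 := fun x hx => by
    linear_combination u * hx + (x - 1) * h3
  have hc : 1 + u ^ k + (u ^ k) ^ 2 = 0 := by
    rcases hk with rfl | rfl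
    · linear_combination hu
    · linear_combination hu + u * h3
  -- As A + B = -1 and AB = 1, A and B are the roots of T² + T + 1, and `u ^ k` is one of these.
  have hprod : (a ^ 3 ^ (j + 1) - u ^ k) * ((u ^ 2 - a) ^ 3 ^ (j + 1) - u ^ k) = 0 := by
    linear_combination hm - u ^ k * hs + hc - u ^ k * hV'
  rcases mul_eq_zero.mp hprod with h | h
  · exact ⟨K, inferInstance, u, a, hu, hu1, hroot a ha, sub_eq_zero.mp h⟩
  · exact ⟨K, inferInstance, u, u ^ 2 - a, hu, hu1, hroot _ (by linear_combination ha),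
      sub_eq_zero.mp h⟩

end EisensteinInteger

/-! ### The abelianization as a quotient of the group ring. -/

namespace FibonacciTypeGroup

variable {n : ℕ} {m k : ℤ}

/-- The image of the generator `x_i` in the abelianization. -/
def abGen (n : ℕ) (m k : ℤ) (i : ZMod n) : Abelianization (FibonacciTypeGroup n m k) :=
  Abelianization.of (PresentedGroup.of i)

lemma abGen_mul (i : ZMod n) :
    abGen n m k i * abGen n m k (i + (m : ZMod n)) = abGen n m k (i + (k : ZMod n)) := by
  have h : (PresentedGroup.mk (fibonacciTypeRels n m k)) (FreeGroup.of i *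
      FreeGroup.of (i + (m : ZMod n)) * (FreeGroup.of (i + (k : ZMod n)))⁻¹) = 1 :=
    PresentedGroup.one_of_mem ⟨i, rfl⟩
  rw [map_mul, map_inv, mul_inv_eq_one, map_mul] at h
  exact (map_mul Abelianization.of _ _).symm.trans (congrArg Abelianization.of h)

/-- The homomorphism to an additive commutative group given by a solution of the relations. -/
def abLift {A : Type*} [AddCommGroup A] (v : ZMod n → A)
    (hv : ∀ i, v i + v (i + (m : ZMod n)) = v (i + (k : ZMod n))) :
    Abelianization (FibonacciTypeGroup n m k) →* Multiplicative A :=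
  Abelianization.lift (PresentedGroup.toGroup (f := fun i => Multiplicative.ofAdd (v i)) (by
    rintro _ ⟨i, rfl⟩
    simp only [map_mul, map_inv, FreeGroup.lift_apply_of]
    rw [← ofAdd_add, hv, mul_inv_cancel]))

lemma abLift_abGen {A : Type*} [AddCommGroup A] (v : ZMod n → A)
    (hv : ∀ i, v i + v (i + (m : ZMod n)) = v (i + (k : ZMod n))) (i : ZMod n) :
    abLift v hv (abGen n m k i) = Multiplicative.ofAdd (v i) := by
  simp [abLift, abGen]

/-- The additive map from the integral group ring of `ℤ/n` to the abelianization. -/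
noncomputable def ofGroupRing (n : ℕ) (m k : ℤ) :
    AddMonoidAlgebra ℤ (ZMod n) →+ Additive (Abelianization (FibonacciTypeGroup n m k)) where
  toFun x := Finsupp.linearCombination ℤ (fun i => Additive.ofMul (abGen n m k i)) x.coeff
  map_zero' := by simp
  map_add' x y := by simp

lemma ofGroupRing_single (i : ZMod n) (c : ℤ) :
    ofGroupRing n m k (AddMonoidAlgebra.single i c) = c • Additive.ofMul (abGen n m k i) := by
  simp [ofGroupRing]

/-- The element `1 + X ^ m - X ^ k` of the group ring. -/
noncomputable def relator (n : ℕ) (m k : ℤ) : AddMonoidAlgebra ℤ (ZMod n) :=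
  AddMonoidAlgebra.single 0 1 + AddMonoidAlgebra.single (m : ZMod n) 1
    - AddMonoidAlgebra.single (k : ZMod n) 1

lemma ofGroupRing_mul_relator (x : AddMonoidAlgebra ℤ (ZMod n)) :
    ofGroupRing n m k (x * relator n m k) = 0 := by
  induction x using AddMonoidAlgebra.induction_linear with
  | zero => simp
  | add x y hx hy => rw [add_mul, map_add, hx, hy, add_zero]
  | single i c =>
    rw [relator, mul_sub, mul_add, AddMonoidAlgebra.single_mul_single,
      AddMonoidAlgebra.single_mul_single, AddMonoidAlgebra.single_mul_single, map_sub, map_add,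
      ofGroupRing_single, ofGroupRing_single, ofGroupRing_single, mul_one, add_zero, ← smul_add,
      ← smul_sub, ← ofMul_mul, abGen_mul, sub_self, smul_zero]

end FibonacciTypeGroup

/-! ### The torsion element. -/

namespace GilbertHowieGroup

open FibonacciTypeGroup EisensteinInteger

/-- The element `x_0 x_1⁻¹ x_2` of the abelianization. -/
def torsionElement (n : ℕ) (m : ℤ) : Abelianization (GilbertHowieGroup n m) :=
  abGen n m 1 0 * (abGen n m 1 1)⁻¹ * abGen n m 1 2

variable {n : ℕ} {m : ℤ} {j r : ℕ}

lemma torsionElement_ne_one (hn : n = 6 * 3 ^ (j + 1)) (hr : r = 1 ∨ r = 2)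
    (hm : (m : ZMod n) = ((2 + 2 * r * 3 ^ (j + 1) : ℕ) : ZMod n)) :
    torsionElement n m ≠ 1 := by
  have : NeZero n := ⟨by rw [hn]; positivity⟩
  -- The exponent 3 - r satisfies 2r(3 - r) = 4 ≡ 1 mod 3, so that a^(2rq) = u.
  obtain ⟨K, _, u, a, hu, hu1, ha, hpow⟩ :=
    exists_field_root j (k := 3 - r) (by rcases hr with rfl | rfl <;> simp)
  have h3 : u ^ 3 = 1 := by linear_combination (u - 1) * hu
  have han : a ^ n = 1 := by
    rw [hn, mul_comm, pow_mul, hpow, ← pow_mul, show (3 - r) * 6 = 3 * ((3 - r) * 2) by ring,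
      pow_mul, h3, one_pow]
  let ψ := AddChar.zmodChar n han
  have hψ1 : ψ 1 = a := by
    simpa using AddChar.zmodChar_apply' han 1
  have hψ2 : ψ 2 = a ^ 2 := by
    simpa using AddChar.zmodChar_apply' han 2
  have hψm : ψ m = u * a ^ 2 := by
    rw [hm, AddChar.zmodChar_apply', pow_add, mul_comm (2 * r), pow_mul, hpow, mul_comm]
    congr 1
    rcases hr with rfl | rfl
    · linear_combination u * h3
    · linear_combination u * h3
  intro h
  have hv : ∀ i : ZMod n, ψ i + ψ (i + (m : ZMod n)) = ψ (i + ((1 : ℤ) : ZMod n)) := fun i => by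
    simp only [AddChar.map_add_eq_mul, Int.cast_one, hψm, hψ1]
    linear_combination ψ i * ha
  have h1 := congrArg (abLift (fun i => ψ i) hv) h
  rw [torsionElement, map_mul, map_mul, map_inv, map_one, abLift_abGen, abLift_abGen,
    abLift_abGen, AddChar.map_zero_eq_one, hψ1, hψ2] at h1
  have h2 : 1 - a + a ^ 2 = 0 := by
    have := congrArg Multiplicative.toAdd h1
    simpa [← sub_eq_add_neg] using this
  have h4 : (u - 1) * a ^ 2 = 0 := by linear_combination ha - h2
  have ha0 : a = 0 := by simpa [sub_eq_zero, hu1] using h4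
  simp [ha0] at ha

lemma isOfFinOrder_torsionElement (hn : n = 6 * 3 ^ (j + 1)) (hr : r = 1 ∨ r = 2)
    (hm : (m : ZMod n) = ((2 + 2 * r * 3 ^ (j + 1) : ℕ) : ZMod n)) :
    IsOfFinOrder (torsionElement n m) := by
  set N : ℤ := QuadraticAlgebra.norm (1 - (1 + 3 * powSum j) ^ 2 : EisensteinInteger) with hN
  let R := AddMonoidAlgebra ℤ (ZMod n)
  let X : R := AddMonoidAlgebra.single 1 1
  have hX : ∀ i : ℕ, X ^ i = AddMonoidAlgebra.single (i : ZMod n) 1 := fun i => by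
    rw [AddMonoidAlgebra.single_pow, one_pow, nsmul_one]
  have hXn : X ^ n = 1 := by rw [hX, ZMod.natCast_self]; rfl
  let w : R := (X ^ 3 ^ (j + 1)) ^ 2
  have hw3 : w ^ 3 = 1 := by
    rw [← hXn, ← pow_mul, ← pow_mul]
    congr 1
    rw [hn]; ring
  let u : R := w ^ r
  have hu3 : u ^ 3 = 1 := by rw [← pow_mul, mul_comm, pow_mul, hw3, one_pow]
  have hwu : w = u ^ r := by
    rcases hr with rfl | rfl
    · simp [u]
    · linear_combination -w * hw3
  have hrel : relator n m 1 = 1 - X + u * X ^ 2 := by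
    have : u * X ^ 2 = X ^ (2 + 2 * r * 3 ^ (j + 1)) := by
      simp only [u, w]; ring
    rw [this, hX, ← hm, relator, Int.cast_one, AddMonoidAlgebra.one_def]
    simp only [X]; abel
  have hmem : (N : R) ∈ Ideal.span {1 - X + u * X ^ 2, u ^ 2 + u + 1} := by
    rw [← Ideal.Quotient.eq_zero_iff_mem, map_intCast]
    set I : Ideal R := Ideal.span {1 - X + u * X ^ 2, u ^ 2 + u + 1}
    refine intCast_norm_eq_zero (u := Ideal.Quotient.mk I u) (a := Ideal.Quotient.mk I X)
      ?_ ?_ hr (j := j) ?_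
    · rw [← map_pow, ← map_add, ← map_one (Ideal.Quotient.mk I), ← map_add]
      exact Ideal.Quotient.eq_zero_iff_mem.mpr (Ideal.subset_span (by simp))
    · rw [← map_pow, ← map_mul, ← map_one (Ideal.Quotient.mk I), ← map_sub, ← map_add]
      exact Ideal.Quotient.eq_zero_iff_mem.mpr (Ideal.subset_span (by simp))
    · rw [← map_pow, ← map_pow, ← map_pow, ← hwu]
  obtain ⟨α, β, hαβ⟩ := Ideal.mem_span_pair.mp hmem
  have hmul : (N : R) * (1 - X + X ^ 2) =
      (α * (1 - X + X ^ 2) + β * (u ^ 2 + u + 1)) * relator n m 1 := by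
    rw [hrel]
    linear_combination -(1 - X + X ^ 2) * hαβ - β * X ^ 2 * hu3
  have hY : ofGroupRing n m 1 (1 - X + X ^ 2) = Additive.ofMul (torsionElement n m) := by
    rw [hX, AddMonoidAlgebra.one_def, map_add, map_sub, ofGroupRing_single, ofGroupRing_single,
      ofGroupRing_single]
    simp [torsionElement, sub_eq_add_neg]
  have hzero : N • Additive.ofMul (torsionElement n m) = 0 := by
    rw [← hY, ← map_zsmul, zsmul_eq_mul, hmul, ofGroupRing_mul_relator]
  exact isOfFinOrder_iff_zpow_eq_one.mpr ⟨N, norm_one_sub_sq_ne_zero j, hzero⟩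

end GilbertHowieGroup

theorem mainTheorem2 (s n : ℕ) (hs : 2 ≤ s) (hn : n = 2 * 3 ^ s) (m : ℤ)
    (hm : m ≡ 2 + (n : ℤ) / 3 [ZMOD (n : ℤ)] ∨ m ≡ 2 - (n : ℤ) / 3 [ZMOD (n : ℤ)]) :
    ¬ Nonempty (Additive (Abelianization (GilbertHowieGroup n m)) ≃+ ℤ × ℤ) ∧
      ∃ x : Abelianization (GilbertHowieGroup n m), x ≠ 1 ∧ IsOfFinOrder x := by
  obtain ⟨j, rfl⟩ := Nat.exists_eq_add_of_le' hs
  have hn' : n = 6 * 3 ^ (j + 1) := by rw [hn]; ring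
  have hdiv : (n : ℤ) / 3 = 2 * 3 ^ (j + 1) := by
    have : (n : ℤ) = 3 * (2 * 3 ^ (j + 1)) := by rw [hn']; push_cast; ring
    rw [this]; exact Int.mul_ediv_cancel_left _ (by norm_num)
  obtain ⟨r, hr, hmr⟩ : ∃ r : ℕ, (r = 1 ∨ r = 2) ∧
      (m : ZMod n) = ((2 + 2 * r * 3 ^ (j + 1) : ℕ) : ZMod n) := by
    have hn0 : (6 : ZMod n) * 3 ^ (j + 1) = 0 := by
      have := ZMod.natCast_self n
      rw [hn'] at this ⊢
      exact_mod_cast this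
    rw [hdiv] at hm
    rcases hm with h | h
    · refine ⟨1, Or.inl rfl, ?_⟩
      rw [(ZMod.intCast_eq_intCast_iff _ _ _).mpr h]
      push_cast; ring
    -- 2 - 2q ≡ 2 + 4q modulo n = 6q.
    · refine ⟨2, Or.inr rfl, ?_⟩
      rw [(ZMod.intCast_eq_intCast_iff _ _ _).mpr h]
      push_cast
      linear_combination -hn0
  have hne := GilbertHowieGroup.torsionElement_ne_one hn' hr hmr
  have hfin := GilbertHowieGroup.isOfFinOrder_torsionElement hn' hr hmr
  refine ⟨?_, _, hne, hfin⟩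
  rintro ⟨e⟩
  obtain ⟨N, hN, hpow⟩ := isOfFinOrder_iff_pow_eq_one.mp hfin
  have h0 : N • e (Additive.ofMul (GilbertHowieGroup.torsionElement n m)) = 0 := by
    rw [← map_nsmul, ← ofMul_pow, hpow, ofMul_one, map_zero]
  rw [smul_eq_zero_iff_right hN.ne', e.map_eq_zero_iff] at h0
  exact hne h0
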